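/- Let $M=(|M|,\mathcal O_M)$ be a smooth supermanifold of dimension $p|q$ (a Hausdorff superspace locally isomorphic to $\mathbb R^{p|q}$), let $x\in|M|$, let $\mathcal O_{M,x}$ be the stalk at $x$ with maximal ideal $\mathfrak m_x$, and let $\mathfrak m_{M,x}\subseteq\mathcal O(M)$ be the ideal of global sections whose value at $x$ is zero. Put $$D^k_x=\{v\in \mathcal O(M)'\;:\; v(\mathfrak m_{M,x}^{k})=0\}\quad(k\ge 0),\qquad D_x=\bigcup_{k\ge 0}D^k_x ,$$ where $\mathcal O(M)'$ is the algebraic dual; the elements of $D^k_x$ are the distributions of order $k$ with support at $x$, and those of $D_x$ the distributions with support at $x$. A super Weil algebra is a finite dimensional real commutative unital superalgebra $A=\mathbb R\oplus N$ with $N$ a graded nilpotent ideal. An $A$-point of $M$ near $x$ is a superalgebra morphism $x_A:\mathcal O(M)\to A$ whose composite with the projection $A\to\mathbb R$ along $N$ is the evaluation at $x$. 1. Let $A$ be a super Weil algebra and $\omega\in A^*$ a linear functional. If $x_A$ is an $A$-point near $x$, then $\omega\circ x_A\in D_x$. Likewise, if $x_A:\mathcal O_{M,x}\to A$ is a superalgebra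 morphism, then its composite with the germ map $\mathcal O(M)\to\mathcal O_{M,x}$ is an $A$-point near $x$, and the composite of $\omega$ with it lies in $D_x$. 2. For every $k\ge 0$, the quotient $A=\mathcal O_{M,x}/\mathfrak m_x^{k+1}$ (with the quotient grading and $N=\mathfrak m_x/\mathfrak m_x^{k+1}$) is a super Weil algebra, the projection $\mathrm{pr}:\mathcal O_{M,x}\to A$ is a superalgebra morphism which, composed with the germ map, is an $A$-point near $x$, and every $v\in D^k_x$ is of the form $v(s)=\omega(\mathrm{pr}([s]_x))$ for all $s \in \mathcal O(M)$, for some $\omega\in A^*$. The same holds for every $v\in D^{k+1}_x$, i.e. for every linear functional that vanishes on $\mathfrak m_{M,x}^{k+1}$. -/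

import Mathlib

open CategoryTheory Opposite TopologicalSpace
open scoped Manifold ContDiff TensorProduct

universe u

/-! ### Commutative superalgebras and super Weil algebras -/

/-- `𝒜 0` and `𝒜 1` are the even and odd part of a grading that makes the real unital algebra `A`
a (super)commutative superalgebra. -/
structure IsSuperalgebra {A : Type*} [Ring A] [Algebra ℝ A] (𝒜 : ZMod 2 → Submodule ℝ A) :
    Prop where
  isCompl : IsCompl (𝒜 0) (𝒜 1)
  one_mem : (1 : A) ∈ 𝒜 0
  mul_mem : ∀ (i j : ZMod 2) (a b : A), a ∈ 𝒜 i → b ∈ 𝒜 j → a * b ∈ 𝒜 (i + j)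
  supercomm : ∀ (i j : ZMod 2) (a b : A), a ∈ 𝒜 i → b ∈ 𝒜 j →
    a * b = ((-1 : ℝ) ^ (i.val * j.val)) • (b * a)

/-- An algebra map is a superalgebra map if it respects the parities. -/
def PreservesParity {A B : Type*} [Ring A] [Algebra ℝ A] [Ring B] [Algebra ℝ B]
    (𝒜 : ZMod 2 → Submodule ℝ A) (ℬ : ZMod 2 → Submodule ℝ B) (f : A →ₐ[ℝ] B) : Prop :=
  ∀ (i : ZMod 2) (a : A), a ∈ 𝒜 i → f a ∈ ℬ i

/-- `A`, graded by `𝒜`, is a super Weil algebra: a finite dimensional commutative superalgebra with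
`A = ℝ ⊕ N`, where `N` is a graded nilpotent (two-sided) ideal. -/
structure IsSuperWeilAlgebra {A : Type*} [Ring A] [Algebra ℝ A] (𝒜 : ZMod 2 → Submodule ℝ A)
    (N : Ideal A) : Prop where
  nontrivial : Nontrivial A
  superalgebra : IsSuperalgebra 𝒜
  finiteDimensional : FiniteDimensional ℝ A
  isTwoSided : N.IsTwoSided
  graded : ∀ a ∈ N, ∃ b ∈ 𝒜 0, ∃ c ∈ 𝒜 1, b ∈ N ∧ c ∈ N ∧ a = b + c
  nilpotent : ∃ n : ℕ, N ^ n = ⊥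
  isCompl : IsCompl (1 : Submodule ℝ A) (N.restrictScalars ℝ)

/-! ### The maximal ideal of a (noncommutative) local ring -/

theorem isUnit_of_isUnit_mul_left {R : Type*} [Ring R] [IsLocalRing R] {a b : R}
    (h : IsUnit (a * b)) : IsUnit b := by
  obtain ⟨u, hu⟩ := h
  have hl : ((↑u⁻¹ : R) * a) * b = 1 := by rw [mul_assoc, ← hu, Units.inv_mul]
  set c : R := (↑u⁻¹ : R) * a
  have key : ∀ e : R, e * e = e → IsUnit e → e = 1 := by
    rintro e he ⟨v, rfl⟩
    have := congrArg (fun t => (↑v⁻¹ : R) * t) he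
    simpa using this
  have hid : (b * c) * (b * c) = b * c := by
    rw [mul_assoc, ← mul_assoc c b c, hl, one_mul]
  rcases IsLocalRing.isUnit_or_isUnit_of_add_one (add_sub_cancel (b * c) 1) with h1 | h1
  · exact ⟨⟨b, c, key _ hid h1, hl⟩, rfl⟩
  · have h2 : (1 - b * c) = 1 := key _ (by simp only [sub_mul, mul_sub, one_mul, mul_one, hid]; abel) h1
    have h3 : b * c = 0 := by simpa using h2
    have : b = 0 := by
      calc b = b * (c * b) := by rw [hl, mul_one]
        _ = 0 := by rw [← mul_assoc, h3, zero_mul]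
    rw [this, mul_zero] at hl
    exact absurd hl zero_ne_one

theorem isUnit_of_isUnit_mul_right {R : Type*} [Ring R] [IsLocalRing R] {a b : R}
    (h : IsUnit (a * b)) : IsUnit a := by
  have hb := isUnit_of_isUnit_mul_left h
  exact (Units.isUnit_mul_units a hb.unit).mp h

/-- The maximal ideal of a local ring: the set of its non-units. -/
def localMaxIdeal (R : Type*) [Ring R] [IsLocalRing R] : Ideal R where
  carrier := nonunits R
  add_mem' := fun ha hb => IsLocalRing.nonunits_add ha hb
  zero_mem' := by simp
  smul_mem' := fun _ _ ha h => ha (isUnit_of_isUnit_mul_left h)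

instance (R : Type*) [Ring R] [IsLocalRing R] : (localMaxIdeal R).IsTwoSided :=
  ⟨fun _ ha h => ha (isUnit_of_isUnit_mul_right h)⟩

/-! ### Superspaces -/

noncomputable section

/-- The stalk at `x` of a presheaf of real algebras. -/
def algStalk {X : TopCat.{u}} (F : X.Presheaf (AlgCat.{u} ℝ)) (x : X) : AlgCat.{u} ℝ :=
  Limits.colimit ((OpenNhds.inclusion x).op ⋙ F)

/-- The germ at `x` of a section over an open neighbourhood of `x`. -/
def algGerm {X : TopCat.{u}} (F : X.Presheaf (AlgCat.{u} ℝ)) (x : X) (U : Opens X)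
    (hx : x ∈ U) : F.obj (op U) →ₐ[ℝ] algStalk F x :=
  (Limits.colimit.ι ((OpenNhds.inclusion x).op ⋙ F) (op ⟨U, hx⟩)).hom

/-- A superspace: a topological space with a sheaf of (real, commutative) superalgebras all of
whose stalks are local. -/
structure Superspace where
  space : TopCat.{u}
  sheaf : TopCat.Sheaf (AlgCat.{u} ℝ) space
  /-- the even and odd sections over an open set -/
  parity : ∀ U : Opens space, ZMod 2 → Submodule ℝ (sheaf.obj.obj (op U))
  superalgebra : ∀ U : Opens space, IsSuperalgebra (parity U)
  parity_res : ∀ (U V : Opens space) (h : U ≤ V),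
    PreservesParity (parity V) (parity U) (sheaf.obj.map (homOfLE h).op).hom
  isLocalRing_stalk : ∀ x : space, IsLocalRing (algStalk sheaf.obj x)

namespace Superspace

variable (M : Superspace.{u})

/-- The algebra of sections over an open set. -/
abbrev Sections (U : Opens M.space) : Type u := M.sheaf.obj.obj (op U)

/-- The algebra of global sections. -/
abbrev Global : Type u := M.Sections ⊤

/-- Restriction of sections. -/
def res {U V : Opens M.space} (h : U ≤ V) : M.Sections V →ₐ[ℝ] M.Sections U :=
  (M.sheaf.obj.map (homOfLE h).op).hom

/-- The stalk at a point. -/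
abbrev Stalk (x : M.space) : Type u := algStalk M.sheaf.obj x

instance (x : M.space) : IsLocalRing (M.Stalk x) := M.isLocalRing_stalk x

/-- The even and odd part of a stalk: the germs of the even and of the odd sections. -/
def stalkParity (x : M.space) (i : ZMod 2) : Submodule ℝ (M.Stalk x) :=
  ⨆ U : {U : Opens M.space // x ∈ U},
    (M.parity U.1 i).map (algGerm M.sheaf.obj x U.1 U.2).toLinearMap

/-- The germ at `x` of a global section. -/
def globalGerm (x : M.space) : M.Global →ₐ[ℝ] M.Stalk x :=
  algGerm M.sheaf.obj x ⊤ trivial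

/-- The maximal ideal of the stalk at `x`. -/
abbrev stalkIdeal (x : M.space) : Ideal (M.Stalk x) := localMaxIdeal (M.Stalk x)

/-- The value of the global section `s` at `x` is the real number `r`, that is, `r` is the number
for which the germ of `s - r` at `x` is not invertible. -/
def HasValueAt (s : M.Global) (x : M.space) (r : ℝ) : Prop :=
  M.globalGerm x (s - algebraMap ℝ M.Global r) ∈ M.stalkIdeal x

/-- The ideal of the global sections whose value at `x` is zero. -/
def pointIdeal (x : M.space) : Ideal M.Global :=
  (M.stalkIdeal x).comap (M.globalGerm x)

theorem mem_pointIdeal_iff (x : M.space) (s : M.Global) :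
    s ∈ M.pointIdeal x ↔ M.HasValueAt s x 0 := by
  simp [pointIdeal, HasValueAt]

/-- A point of `M` with values in the super Weil algebra `A = ℝ ⊕ N` (graded by `𝒜`), near `x`: a
superalgebra map `xA` from the global sections to `A` whose composite with the projection of `A`
onto `ℝ` along `N` is the evaluation of sections at `x`. -/
structure IsWeilPointNear {A : Type*} [Ring A] [Algebra ℝ A] (𝒜 : ZMod 2 → Submodule ℝ A)
    (N : Ideal A) (x : M.space) (xA : M.Global →ₐ[ℝ] A) : Prop where
  preservesParity : PreservesParity (M.parity ⊤) 𝒜 xA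
  near : ∀ s : M.Global, ∃ r : ℝ, M.HasValueAt s x r ∧ xA s - algebraMap ℝ A r ∈ N

/-- `k`-th step of the filtration of the distributions with support at `x`: the linear functionals
on the global sections that vanish on the `k`-th power of the ideal of `x`. -/
def distributionsOfOrder (x : M.space) (k : ℕ) : Set (Module.Dual ℝ M.Global) :=
  {v | ∀ s ∈ M.pointIdeal x ^ k, v s = 0}

/-- The distributions with support at `x`. -/
def distributions (x : M.space) : Set (Module.Dual ℝ M.Global) :=
  ⋃ k : ℕ, M.distributionsOfOrder x k

/-- The quotient of the stalk at `x` by the power `k + 1` of its maximal ideal. -/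
abbrev Jet (x : M.space) (k : ℕ) : Type u := M.Stalk x ⧸ M.stalkIdeal x ^ (k + 1)

/-- The canonical projection of the stalk onto its quotient. -/
def jetProj (x : M.space) (k : ℕ) : M.Stalk x →ₐ[ℝ] M.Jet x k :=
  Ideal.Quotient.mkₐ ℝ (M.stalkIdeal x ^ (k + 1))

/-- The quotient grading. -/
def jetParity (x : M.space) (k : ℕ) (i : ZMod 2) : Submodule ℝ (M.Jet x k) :=
  (M.stalkParity x i).map (M.jetProj x k).toLinearMap

/-- The image of the maximal ideal of the stalk. -/
def jetIdeal (x : M.space) (k : ℕ) : Ideal (M.Jet x k) :=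
  (M.stalkIdeal x).map (M.jetProj x k)

end Superspace

/-! ### Supermanifolds -/

/-- Smooth real functions on an open subset of `ℝᵖ`. -/
abbrev SmoothFun (p : ℕ) (W : Opens (EuclideanSpace ℝ (Fin p))) : Type :=
  C^∞⟮𝓘(ℝ, EuclideanSpace ℝ (Fin p)), W; 𝓘(ℝ, ℝ), ℝ⟯

/-- The Grassmann algebra on `q` generators. -/
abbrev Grassmann (q : ℕ) : Type := ExteriorAlgebra ℝ (Fin q → ℝ)

/-- Sections over `W` of the structure sheaf of the smooth local model of dimension `p|q`. -/
abbrev ModelSections (p q : ℕ) (W : Opens (EuclideanSpace ℝ (Fin p))) : Type :=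
  SmoothFun p W ⊗[ℝ] Grassmann q

/-- Restriction of smooth functions. -/
def smoothRes (p : ℕ) {W W' : Opens (EuclideanSpace ℝ (Fin p))} (h : W ≤ W') :
    SmoothFun p W' →ₐ[ℝ] SmoothFun p W :=
  { ContMDiffMap.restrictRingHom (𝓘(ℝ, EuclideanSpace ℝ (Fin p))) (𝓘(ℝ, ℝ)) ℝ h with
    commutes' := fun _ => rfl }

/-- Restriction of sections of the local model. -/
def modelRes (p q : ℕ) {W W' : Opens (EuclideanSpace ℝ (Fin p))} (h : W ≤ W') :
    ModelSections p q W' →ₐ[ℝ] ModelSections p q W :=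
  Algebra.TensorProduct.map (smoothRes p h) (AlgHom.id ℝ (Grassmann q))

/-- Even and odd sections of the local model: smooth functions are even and the generators of the
Grassmann algebra are odd. -/
def modelParity (p q : ℕ) (W : Opens (EuclideanSpace ℝ (Fin p))) (i : ZMod 2) :
    Submodule ℝ (ModelSections p q W) :=
  LinearMap.range (TensorProduct.map (LinearMap.id : SmoothFun p W →ₗ[ℝ] SmoothFun p W)
    (CliffordAlgebra.evenOdd (0 : QuadraticForm ℝ (Fin q → ℝ)) i).subtype)

/-- A chart of dimension `p|q`: an isomorphism of the restriction of `M` to an open set with the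
restriction of the local model to an open subset of `ℝᵖ`, given by a homeomorphism `φ` and parity
preserving algebra isomorphisms, compatible with restriction, between the sections over `φ⁻¹(W)`
and the sections of the model over `W`. -/
structure SuperChart (p q : ℕ) (M : Superspace.{u}) where
  φ : OpenPartialHomeomorph M.space (EuclideanSpace ℝ (Fin p))
  iso : ∀ W : Opens (EuclideanSpace ℝ (Fin p)), (W : Set (EuclideanSpace ℝ (Fin p))) ⊆ φ.target →
    M.Sections ⟨φ.source ∩ φ ⁻¹' W, φ.isOpen_inter_preimage W.isOpen⟩ ≃ₐ[ℝ] ModelSections p q W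
  iso_parity : ∀ W hW i s, s ∈ M.parity _ i ↔ iso W hW s ∈ modelParity p q W i
  iso_res : ∀ W W' hW hW' (h : W ≤ W') s,
    iso W hW (M.res (Set.inter_subset_inter_right _ (Set.preimage_mono h)) s) = modelRes p q h (iso W' hW' s)

/-- `M` is a smooth supermanifold of dimension `p|q`: a Hausdorff superspace that is locally
isomorphic to the local model. -/
structure IsSupermanifold (p q : ℕ) (M : Superspace.{u}) : Prop where
  t2Space : T2Space M.space
  exists_chart : ∀ x : M.space, ∃ c : SuperChart p q M, x ∈ c.φ.source

end

/-! For an `A`-point near `x`, a section with value zero at `x` goes into the nilpotent ideal `N`,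
so some power of `M.pointIdeal x` is killed. A morphism out of the stalk gives such a point: the
value of a germ at `x` is the only scalar whose difference with the germ is a non-unit, and an
element with nilpotent image is a non-unit (`IsSuperWeilAlgebra.map_localMaxIdeal_le`).

For the converse, two facts about a supermanifold are needed. Hadamard's lemma in a chart shows that
the stalk has residue field `ℝ` and that its maximal ideal is generated by the `p + q` coordinate
germs (`SuperChart.stalkIdeal_eq_coordIdeal`); hence the jets are finite dimensional. The maximal
ideal is graded because odd elements square to zero, so the grading descends to the jets.

Bump functions, which exist because `M` is Hausdorff (`SuperChart.hasBumps`), make the germ map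
surjective and put every section with zero germ into all powers of `M.pointIdeal x`. Hence a section
whose germ lies in the `n`-th power of the maximal ideal lies in the `n`-th power of `M.pointIdeal
x` (`mem_pow_pointIdeal`). A functional vanishing on the power `k + 1` therefore vanishes on the
kernel of the map to the jets, and factors through it. -/

namespace Superspace

/-! ### Germs, restriction and gluing of two sections -/

variable (M : Superspace.{u})

/-- The germ at `x` of a section over an open neighbourhood of `x`. -/
noncomputable def germ {x : M.space} {U : Opens M.space} (hx : x ∈ U) :
    M.Sections U →ₐ[ℝ] M.Stalk x :=
  algGerm M.sheaf.obj x U hx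

theorem res_res {U V W : Opens M.space} (h : U ≤ V) (h' : V ≤ W) (s : M.Sections W) :
    M.res h (M.res h' s) = M.res (h.trans h') s := by
  have : M.sheaf.obj.map (homOfLE (h.trans h')).op =
      M.sheaf.obj.map (homOfLE h').op ≫ M.sheaf.obj.map (homOfLE h).op := by
    rw [← Functor.map_comp]; rfl
  simp only [res]
  rw [this]
  rfl

theorem germ_res {x : M.space} {U V : Opens M.space} (hx : x ∈ U) (h : U ≤ V)
    (s : M.Sections V) : M.germ hx (M.res h s) = M.germ (h hx) s := by
  have := Limits.colimit.w ((OpenNhds.inclusion x).op ⋙ M.sheaf.obj)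
    (homOfLE h : (⟨U, hx⟩ : OpenNhds x) ⟶ ⟨V, h hx⟩).op
  exact congrArg (fun f => f.hom s) this

theorem exists_germ_eq {x : M.space} (g : M.Stalk x) :
    ∃ (U : Opens M.space) (hx : x ∈ U) (s : M.Sections U), M.germ hx s = g := by
  obtain ⟨j, s, hs⟩ := Limits.Concrete.colimit_exists_rep
    ((OpenNhds.inclusion x).op ⋙ M.sheaf.obj) g
  exact ⟨j.unop.1, j.unop.2, s, hs⟩

theorem germ_eq {x : M.space} {U V : Opens M.space} (hU : x ∈ U) (hV : x ∈ V)
    {s : M.Sections U} {t : M.Sections V} (h : M.germ hU s = M.germ hV t) :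
    ∃ (W : Opens M.space) (_ : x ∈ W) (iU : W ≤ U) (iV : W ≤ V), M.res iU s = M.res iV t := by
  obtain ⟨k, f, g, hk⟩ := Limits.Concrete.colimit_exists_of_rep_eq
    ((OpenNhds.inclusion x).op ⋙ M.sheaf.obj) (i := op ⟨U, hU⟩) (j := op ⟨V, hV⟩) s t h
  exact ⟨k.unop.1, k.unop.2, leOfHom f.unop, leOfHom g.unop, hk⟩

theorem exists_glue {U V : Opens M.space} (hUV : ⊤ ≤ U ⊔ V) (s : M.Sections U) (t : M.Sections V)
    (h : M.res (inf_le_left : U ⊓ V ≤ U) s = M.res (inf_le_right : U ⊓ V ≤ V) t) :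
    ∃ r : M.Global, M.res le_top r = s ∧ M.res le_top r = t := by
  let W : ULift.{u} Bool → Opens M.space := fun b => cond b.down U V
  let sf : ∀ b, M.Sections (W b) := fun b => match b with
    | ⟨true⟩ => s
    | ⟨false⟩ => t
  have hc : ⊤ ≤ iSup W := hUV.trans (sup_le (le_iSup W ⟨true⟩) (le_iSup W ⟨false⟩))
  obtain ⟨r, hr, -⟩ := M.sheaf.existsUnique_gluing' W ⊤ (fun b => homOfLE le_top) hc sf (by
    rintro ⟨_ | _⟩ ⟨_ | _⟩
    · rfl
    -- `V ⊓ U` and `U ⊓ V` are different terms, so the compatibility is transported by a further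
    -- restriction.
    · have := congrArg (M.res (U := V ⊓ U) (le_of_eq (inf_comm _ _))) h.symm
      rw [res_res, res_res] at this
      exact this
    · exact h
    · rfl)
  exact ⟨r, hr ⟨true⟩, hr ⟨false⟩⟩

theorem eq_of_res_eq {U V : Opens M.space} (hUV : ⊤ ≤ U ⊔ V) {s t : M.Global}
    (hU : M.res (le_top : U ≤ ⊤) s = M.res le_top t)
    (hV : M.res (le_top : V ≤ ⊤) s = M.res le_top t) : s = t :=
  M.sheaf.eq_of_locally_eq₂ (homOfLE le_top) (homOfLE le_top) hUV s t hU hV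

end Superspace

/-! ### Graded ideals of superalgebras -/

/-- A left ideal of a superalgebra is graded if it contains the even and the odd part of each of
its elements. -/
def IsGradedIdeal {A : Type*} [Ring A] [Algebra ℝ A] (𝒜 : ZMod 2 → Submodule ℝ A)
    (I : Ideal A) : Prop :=
  ∀ a ∈ I, ∃ b ∈ 𝒜 0, ∃ c ∈ 𝒜 1, b ∈ I ∧ c ∈ I ∧ a = b + c

section Graded

variable {A : Type*} [Ring A] [Algebra ℝ A] {𝒜 : ZMod 2 → Submodule ℝ A}

theorem IsSuperalgebra.exists_eq_add (h : IsSuperalgebra 𝒜) (a : A) :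
    ∃ b ∈ 𝒜 0, ∃ c ∈ 𝒜 1, a = b + c := by
  have : a ∈ 𝒜 0 ⊔ 𝒜 1 := by rw [h.isCompl.sup_eq_top]; trivial
  obtain ⟨b, hb, c, hc, hbc⟩ := Submodule.mem_sup.mp this
  exact ⟨b, hb, c, hc, hbc.symm⟩

/-- An odd element anticommutes with itself, and 2 is invertible in `ℝ`. -/
theorem IsSuperalgebra.mul_self_eq_zero (h : IsSuperalgebra 𝒜) {a : A} (ha : a ∈ 𝒜 1) :
    a * a = 0 := by
  have h1 := h.supercomm 1 1 a a ha ha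
  rw [show ((1 : ZMod 2).val * (1 : ZMod 2).val) = 1 from rfl, pow_one, neg_one_smul] at h1
  have h3 : (2 : ℝ) • (a * a) = 0 := by rw [two_smul]; nth_rewrite 1 [h1]; exact neg_add_cancel _
  exact (smul_eq_zero.mp h3).resolve_left two_ne_zero

theorem IsSuperalgebra.eq_of_add_eq_add (h : IsSuperalgebra 𝒜) {b b' c c' : A}
    (hb : b ∈ 𝒜 0) (hb' : b' ∈ 𝒜 0) (hc : c ∈ 𝒜 1) (hc' : c' ∈ 𝒜 1)
    (e : b + c = b' + c') : b = b' ∧ c = c' := by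
  have e' : b - b' = c' - c := by rw [sub_eq_sub_iff_add_eq_add, e, add_comm]
  have h0 : b - b' = 0 := Submodule.disjoint_def.mp h.isCompl.disjoint _ (sub_mem hb hb')
    (e' ▸ sub_mem hc' hc)
  refine ⟨sub_eq_zero.mp h0, ?_⟩
  rw [h0] at e'
  exact (sub_eq_zero.mp e'.symm).symm

theorem IsGradedIdeal.mul (h : IsSuperalgebra 𝒜) {I J : Ideal A} (hI : IsGradedIdeal 𝒜 I)
    (hJ : IsGradedIdeal 𝒜 J) : IsGradedIdeal 𝒜 (I * J) := by
  intro a ha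
  induction ha using Submodule.mul_induction_on' with
  | mem_mul_mem m hm n hn =>
    obtain ⟨b, hb, c, hc, hbI, hcI, rfl⟩ := hI m hm
    obtain ⟨b', hb', c', hc', hbJ, hcJ, rfl⟩ := hJ n hn
    refine ⟨b * b' + c * c', ?_, b * c' + c * b', ?_, ?_, ?_, by noncomm_ring⟩
    · exact add_mem (h.mul_mem 0 0 _ _ hb hb') (h.mul_mem 1 1 _ _ hc hc')
    · exact add_mem (h.mul_mem 0 1 _ _ hb hc') (h.mul_mem 1 0 _ _ hc hb')
    · exact add_mem (Ideal.mul_mem_mul hbI hbJ) (Ideal.mul_mem_mul hcI hcJ)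
    · exact add_mem (Ideal.mul_mem_mul hbI hcJ) (Ideal.mul_mem_mul hcI hbJ)
  | add x _ y _ hx hy =>
    obtain ⟨b, hb, c, hc, hbI, hcI, rfl⟩ := hx
    obtain ⟨b', hb', c', hc', hbJ, hcJ, rfl⟩ := hy
    exact ⟨b + b', add_mem hb hb', c + c', add_mem hc hc', add_mem hbI hbJ, add_mem hcI hcJ,
      by abel⟩

theorem IsGradedIdeal.pow (h : IsSuperalgebra 𝒜) {I : Ideal A} (hI : IsGradedIdeal 𝒜 I) (n : ℕ) :
    IsGradedIdeal 𝒜 (I ^ n) := by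
  induction n with
  | zero =>
    intro a _
    obtain ⟨b, hb, c, hc, e⟩ := h.exists_eq_add a
    rw [Submodule.pow_zero, Ideal.one_eq_top]
    exact ⟨b, hb, c, hc, trivial, trivial, e⟩
  | succ n ih =>
    rw [Submodule.pow_succ]
    exact ih.mul h hI

theorem IsGradedIdeal.map {B : Type*} [Ring B] [Algebra ℝ B]
    {f : A →ₐ[ℝ] B} (hf : Function.Surjective f) {I : Ideal A} (hI : IsGradedIdeal 𝒜 I) :
    IsGradedIdeal (fun i => (𝒜 i).map f.toLinearMap) (I.map f) := by
  intro y hy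
  obtain ⟨a, ha, rfl⟩ := (Ideal.mem_map_iff_of_surjective f hf).mp hy
  obtain ⟨b, hb, c, hc, hbI, hcI, rfl⟩ := hI a ha
  exact ⟨f b, ⟨b, hb, rfl⟩, f c, ⟨c, hc, rfl⟩, Ideal.mem_map_of_mem f hbI,
    Ideal.mem_map_of_mem f hcI, map_add f b c⟩

/-- The quotient of a superalgebra by a graded ideal is a superalgebra. -/
theorem IsSuperalgebra.map (h : IsSuperalgebra 𝒜) {B : Type*} [Ring B] [Algebra ℝ B]
    {f : A →ₐ[ℝ] B} (hf : Function.Surjective f) (hker : IsGradedIdeal 𝒜 (RingHom.ker f)) :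
    IsSuperalgebra (fun i => (𝒜 i).map f.toLinearMap) where
  isCompl := by
    refine ⟨?_, ?_⟩
    · rw [Submodule.disjoint_def]
      rintro _ ⟨b, hb, rfl⟩ ⟨c, hc, hbc⟩
      -- If an even `b` and an odd `c` have the same image, `b` is the even component of `b - c`.
      -- The kernel is graded, so it contains `b`, and the common image is zero.
      have hbc' : b - c ∈ RingHom.ker f := by
        rw [RingHom.mem_ker, map_sub, sub_eq_zero]; exact hbc.symm
      obtain ⟨b', hb', c', hc', hbI, -, e⟩ := hker _ hbc'
      rw [sub_eq_add_neg] at e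
      rw [(h.eq_of_add_eq_add hb hb' (neg_mem hc) hc' e).1]
      exact hbI
    · rw [codisjoint_iff, eq_top_iff]
      rintro y -
      obtain ⟨a, rfl⟩ := hf y
      obtain ⟨b, hb, c, hc, rfl⟩ := h.exists_eq_add a
      rw [map_add]
      exact Submodule.add_mem_sup ⟨b, hb, rfl⟩ ⟨c, hc, rfl⟩
  one_mem := ⟨1, h.one_mem, map_one f⟩
  mul_mem := by
    rintro i j _ _ ⟨a, ha, rfl⟩ ⟨b, hb, rfl⟩
    exact ⟨a * b, h.mul_mem i j a b ha hb, map_mul f a b⟩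
  supercomm := by
    rintro i j _ _ ⟨a, ha, rfl⟩ ⟨b, hb, rfl⟩
    have := congrArg f (h.supercomm i j a b ha hb)
    rw [map_mul, map_smul, map_mul] at this
    exact this

end Graded

/-! ### Local superalgebras -/

section LocalAlgebra

variable {R : Type*} [Ring R] [IsLocalRing R]

theorem mem_localMaxIdeal {a : R} : a ∈ localMaxIdeal R ↔ ¬ IsUnit a := Iff.rfl

theorem localMaxIdeal_ne_top : localMaxIdeal R ≠ ⊤ := fun h =>
  mem_localMaxIdeal.mp ((Ideal.eq_top_iff_one _).mp h) isUnit_one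

theorem mem_localMaxIdeal_of_isNilpotent {a : R} (h : IsNilpotent a) : a ∈ localMaxIdeal R :=
  fun hu => h.not_isUnit hu

variable [Algebra ℝ R]

theorem algebraMap_mem_localMaxIdeal {r : ℝ} :
    algebraMap ℝ R r ∈ localMaxIdeal R ↔ r = 0 := by
  refine ⟨fun h => ?_, fun h => by simp [h]⟩
  by_contra hr
  exact mem_localMaxIdeal.mp h ((isUnit_iff_ne_zero.mpr hr).map (algebraMap ℝ R))

/-- Odd elements are nilpotent, hence non-units; subtracting the odd part of a non-unit leaves its
even part in the maximal ideal. -/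
theorem IsSuperalgebra.isGradedIdeal_localMaxIdeal {𝒜 : ZMod 2 → Submodule ℝ R}
    (h : IsSuperalgebra 𝒜) : IsGradedIdeal 𝒜 (localMaxIdeal R) := by
  intro a ha
  obtain ⟨b, hb, c, hc, rfl⟩ := h.exists_eq_add a
  have hcm : c ∈ localMaxIdeal R :=
    mem_localMaxIdeal_of_isNilpotent ⟨2, by rw [pow_two, h.mul_self_eq_zero hc]⟩
  exact ⟨b, hb, c, hc, by simpa using sub_mem ha hcm, hcm, rfl⟩

/-- A local algebra with residue field `ℝ` and finitely generated maximal ideal is spanned, modulo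
every power of the maximal ideal, by finitely many elements. -/
theorem exists_fg_sup_pow_localMaxIdeal (hval : ∀ a : R, ∃ r : ℝ, a - algebraMap ℝ R r ∈
      localMaxIdeal R) (hfg : (localMaxIdeal R).FG) (k : ℕ) :
    ∃ V : Submodule ℝ R, V.FG ∧
      V ⊔ (localMaxIdeal R ^ (k + 1)).restrictScalars ℝ = ⊤ := by
  have h1 : (1 : Submodule ℝ R).FG := Submodule.one_eq_span (R := ℝ) (A := R) ▸
    Submodule.fg_span_singleton 1
  obtain ⟨T, hT⟩ := hfg
  induction k with
  | zero =>
    refine ⟨1, h1, eq_top_iff.mpr fun a _ => ?_⟩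
    obtain ⟨r, hr⟩ := hval a
    refine Submodule.mem_sup.mpr ⟨algebraMap ℝ R r, ⟨r, (Algebra.algebraMap_eq_smul_one r).symm⟩, _, ?_, add_sub_cancel _ a⟩
    simpa [Submodule.pow_one] using hr
  | succ k ih =>
    obtain ⟨V, hV, hVT⟩ := ih
    -- With `m` the maximal ideal, `R = ℝ + m` and `m = R·T`. Inserting `R = V + m^(k+1)` gives `m ⊆
    -- V·T + m^(k+2)`.
    refine ⟨1 ⊔ V * Submodule.span ℝ (T : Set R),
      Submodule.FG.sup h1 (hV.mul ⟨T, rfl⟩), eq_top_iff.mpr fun a _ => ?_⟩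
    -- The left factor `c` stays universally quantified, so that the scalar step of the induction
    -- over a left ideal can absorb the new coefficient into it.
    have key : ∀ b ∈ Ideal.span (T : Set R), ∀ c : R, c * b ∈ V * Submodule.span ℝ (T : Set R) ⊔
        (localMaxIdeal R ^ (k + 1 + 1)).restrictScalars ℝ := by
      intro b hb
      induction hb using Submodule.span_induction with
      | mem t ht =>
        intro c
        obtain ⟨v, hv, w, hw, rfl⟩ := Submodule.mem_sup.mp (hVT.ge (Submodule.mem_top (x := c)))
        rw [add_mul]
        refine Submodule.add_mem_sup (Submodule.mul_mem_mul hv (Submodule.subset_span ht)) ?_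
        change w * t ∈ localMaxIdeal R ^ (k + 1 + 1)
        rw [Submodule.pow_succ (n := k + 1)]
        exact Ideal.mul_mem_mul hw (hT ▸ Submodule.subset_span ht)
      | zero => simp
      | add x y _ _ hx hy => exact fun c => mul_add c x y ▸ add_mem (hx c) (hy c)
      | smul d x _ hx => exact fun c => by rw [smul_eq_mul, ← mul_assoc]; exact hx (c * d)
    obtain ⟨r, hr⟩ := hval a
    rw [sup_assoc]
    exact Submodule.mem_sup.mpr ⟨algebraMap ℝ R r, ⟨r, (Algebra.algebraMap_eq_smul_one r).symm⟩, _, one_mul (a - algebraMap ℝ R r) ▸ key _ (hT ▸ hr) 1,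
      add_sub_cancel _ a⟩

/-- By surjectivity every element of a mapped ideal is itself an image, so products of such elements
lift to products. -/
theorem Ideal.map_pow_le_of_surjective {A B : Type*} [Ring A] [Algebra ℝ A] [Ring B] [Algebra ℝ B]
    {f : A →ₐ[ℝ] B} (hf : Function.Surjective f) (I : Ideal A) (n : ℕ) :
    I.map f ^ n ≤ (I ^ n).map f := by
  induction n with
  | zero => simp [Submodule.pow_zero, Ideal.one_eq_top, Ideal.map_top]
  | succ n ih =>
    rw [Submodule.pow_succ, Submodule.pow_succ]
    refine Ideal.mul_le.mpr fun x hx y hy => ?_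
    obtain ⟨a, ha, rfl⟩ := (Ideal.mem_map_iff_of_surjective f hf).mp (ih hx)
    obtain ⟨b, hb, rfl⟩ := (Ideal.mem_map_iff_of_surjective f hf).mp hy
    rw [← map_mul]
    exact Ideal.mem_map_of_mem f (Ideal.mul_mem_mul ha hb)

/-- The quotients of a local superalgebra with residue field `ℝ` and finitely generated maximal
ideal by the positive powers of the maximal ideal are super Weil algebras. -/
theorem IsSuperalgebra.isSuperWeilAlgebra_quotient {𝒜 : ZMod 2 → Submodule ℝ R}
    (h : IsSuperalgebra 𝒜)
    (hval : ∀ a : R, ∃ r : ℝ, a - algebraMap ℝ R r ∈ localMaxIdeal R)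
    (hfg : (localMaxIdeal R).FG) (k : ℕ) :
    IsSuperWeilAlgebra
      (fun i => (𝒜 i).map (Ideal.Quotient.mkₐ ℝ (localMaxIdeal R ^ (k + 1))).toLinearMap)
      ((localMaxIdeal R).map (Ideal.Quotient.mkₐ ℝ (localMaxIdeal R ^ (k + 1)))) := by
  have hsurj := Ideal.Quotient.mkₐ_surjective ℝ (localMaxIdeal R ^ (k + 1))
  have hker : RingHom.ker (Ideal.Quotient.mkₐ ℝ (localMaxIdeal R ^ (k + 1))) =
    localMaxIdeal R ^ (k + 1) := Ideal.Quotient.mkₐ_ker ℝ _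
  have hzero : ∀ a ∈ localMaxIdeal R ^ (k + 1),
      Ideal.Quotient.mkₐ ℝ (localMaxIdeal R ^ (k + 1)) a = 0 :=
    fun a ha => Ideal.Quotient.eq_zero_iff_mem.mpr ha
  set f := Ideal.Quotient.mkₐ ℝ (localMaxIdeal R ^ (k + 1))
  -- The exponent is positive, so the kernel of `f` lies in the maximal ideal, which is therefore
  -- the full preimage of its image. This also makes the quotient nontrivial.
  have hle : localMaxIdeal R ^ (k + 1) ≤ localMaxIdeal R := Ideal.pow_le_self k.succ_ne_zero
  have hmem : ∀ a, f a ∈ (localMaxIdeal R).map f ↔ a ∈ localMaxIdeal R := by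
    refine fun a => ⟨fun ha => ?_, Ideal.mem_map_of_mem f⟩
    obtain ⟨b, hb, e⟩ := (Ideal.mem_map_iff_of_surjective f hsurj).mp ha
    have : a - b ∈ RingHom.ker f := by rw [RingHom.mem_ker, map_sub, e, sub_self]
    exact sub_add_cancel a b ▸ add_mem (hle (hker ▸ this)) hb
  have hgr := h.isGradedIdeal_localMaxIdeal
  refine ⟨?_, h.map hsurj (by rw [hker]; exact hgr.pow h _), ?_, ?_, hgr.map hsurj, ⟨k + 1, ?_⟩, ?_⟩
  · exact Ideal.Quotient.nontrivial_iff.mpr fun e => localMaxIdeal_ne_top (top_le_iff.mp (e ▸ hle))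
  · obtain ⟨V, hV, hVT⟩ := exists_fg_sup_pow_localMaxIdeal hval hfg k
    refine ⟨?_⟩
    have : (⊤ : Submodule ℝ (R ⧸ localMaxIdeal R ^ (k + 1))) = V.map f.toLinearMap := by
      refine (eq_top_iff.mpr fun y _ => ?_).symm
      obtain ⟨a, rfl⟩ := hsurj y
      obtain ⟨v, hv, w, hw, rfl⟩ := Submodule.mem_sup.mp (hVT.ge (Submodule.mem_top (x := a)))
      have hw' : f w = 0 := hzero w hw
      exact ⟨v, hv, by rw [map_add, hw', add_zero]; rfl⟩
    rw [this]
    exact hV.map _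
  · refine ⟨fun {y} b hy => ?_⟩
    obtain ⟨a, ha, rfl⟩ := (Ideal.mem_map_iff_of_surjective f hsurj).mp hy
    obtain ⟨c, rfl⟩ := hsurj b
    rw [← map_mul]
    exact Ideal.mem_map_of_mem f (Ideal.mul_mem_right _ _ ha)
  · rw [eq_bot_iff]
    refine (Ideal.map_pow_le_of_surjective hsurj _ _).trans (Ideal.map_le_iff_le_comap.mpr ?_)
    exact fun a ha => hzero a ha
  · refine ⟨Submodule.disjoint_def.mpr ?_, codisjoint_iff.mpr (eq_top_iff.mpr fun y _ => ?_)⟩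
    · rintro y hy hy'
      obtain ⟨r, rfl⟩ := Submodule.mem_one.mp hy
      rw [← f.commutes, Submodule.restrictScalars_mem, hmem, algebraMap_mem_localMaxIdeal] at hy'
      rw [hy', map_zero]
    · obtain ⟨a, rfl⟩ := hsurj y
      obtain ⟨r, hr⟩ := hval a
      refine Submodule.mem_sup.mpr ⟨algebraMap ℝ _ r, Submodule.mem_one.mpr ⟨r, rfl⟩, _,
        Ideal.mem_map_of_mem f hr, ?_⟩
      rw [map_sub, f.commutes, add_sub_cancel]

end LocalAlgebra

/-! ### Functionals on super Weil algebras -/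

theorem IsSuperWeilAlgebra.isNilpotent_of_mem {A : Type*} [Ring A] [Algebra ℝ A]
    {𝒜 : ZMod 2 → Submodule ℝ A} {N : Ideal A} (h : IsSuperWeilAlgebra 𝒜 N) {a : A} (ha : a ∈ N) :
    IsNilpotent a := by
  obtain ⟨n, hn⟩ := h.nilpotent
  refine ⟨n, ?_⟩
  have : ∀ n : ℕ, a ^ n ∈ N ^ n := by
    intro n
    induction n with
    | zero => simp [Submodule.pow_zero, Ideal.one_eq_top]
    | succ n ih => rw [pow_succ, Submodule.pow_succ]; exact Ideal.mul_mem_mul ih ha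
  simpa [hn] using this n

/-- Write `f a = r + n` with `n ∈ N`. The image `n` of `a - r` is nilpotent, so `a - r` is a
non-unit; together with `a` this puts the scalar `r` into the maximal ideal, whence `r = 0`. -/
theorem IsSuperWeilAlgebra.map_localMaxIdeal_le {A R : Type*} [Ring A] [Algebra ℝ A] [Ring R]
    [IsLocalRing R] [Algebra ℝ R] {𝒜 : ZMod 2 → Submodule ℝ A} {N : Ideal A}
    (h : IsSuperWeilAlgebra 𝒜 N) (f : R →ₐ[ℝ] A) {a : R} (ha : a ∈ localMaxIdeal R) : f a ∈ N := by
  have := h.nontrivial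
  obtain ⟨y, hy, n, hn, e⟩ := Submodule.mem_sup.mp
    (h.isCompl.sup_eq_top.ge (Submodule.mem_top (x := f a)))
  obtain ⟨r, rfl⟩ := Submodule.mem_one.mp hy
  have hfn : f (a - algebraMap ℝ R r) = n := by
    rw [map_sub, ← e, f.commutes, add_sub_cancel_left]
  have hmem : a - algebraMap ℝ R r ∈ localMaxIdeal R := fun hu =>
    (h.isNilpotent_of_mem hn).not_isUnit (hfn ▸ hu.map f)
  have hr : r = 0 := algebraMap_mem_localMaxIdeal.mp (by simpa using sub_mem ha hmem)
  rw [← e, hr, map_zero, zero_add]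
  exact hn

theorem Ideal.map_mem_pow {R S : Type*} [Ring R] [Ring S] (f : R →+* S) {I : Ideal R}
    {J : Ideal S} (h : ∀ a ∈ I, f a ∈ J) (n : ℕ) {a : R} (ha : a ∈ I ^ n) : f a ∈ J ^ n := by
  induction n generalizing a with
  | zero => simp [Submodule.pow_zero, Ideal.one_eq_top]
  | succ n ih =>
    rw [Submodule.pow_succ] at ha ⊢
    induction ha using Submodule.mul_induction_on' with
    | mem_mul_mem x hx y hy => rw [map_mul]; exact Ideal.mul_mem_mul (ih hx) (h y hy)
    | add x _ y _ hx hy => rw [map_add]; exact add_mem hx hy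

namespace Superspace

variable (M : Superspace.{u})

theorem IsWeilPointNear.comp_mem_distributions {A : Type*} [Ring A] [Algebra ℝ A]
    {𝒜 : ZMod 2 → Submodule ℝ A} {N : Ideal A} (hA : IsSuperWeilAlgebra 𝒜 N) {x : M.space}
    {xA : M.Global →ₐ[ℝ] A} (h : M.IsWeilPointNear 𝒜 N x xA) (w : Module.Dual ℝ A) :
    w ∘ₗ xA.toLinearMap ∈ M.distributions x := by
  obtain ⟨n, hn⟩ := hA.nilpotent
  refine Set.mem_iUnion.mpr ⟨n, fun s hs => ?_⟩
  have hI : ∀ a ∈ M.pointIdeal x, xA a ∈ N := by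
    intro a ha
    obtain ⟨r, hr, hN⟩ := h.near a
    -- Values are unique: the germs of `a` and of `a - r` both lie in the maximal ideal, so the
    -- constant `r` does too and must be zero.
    have hr' : M.globalGerm x a - M.globalGerm x (a - algebraMap ℝ M.Global r) ∈
      M.stalkIdeal x := sub_mem ha hr
    rw [← map_sub, sub_sub_cancel, AlgHom.commutes, algebraMap_mem_localMaxIdeal] at hr'
    simpa [hr'] using hN
  have := Ideal.map_mem_pow (xA : M.Global →+* A) hI n hs
  rw [hn] at this
  have h0 : xA s = 0 := this
  simp [h0]

end Superspace

/-! ### Hadamard's lemma -/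

section Hadamard

open MeasureTheory

variable {E F : Type*} [NormedAddCommGroup E] [NormedSpace ℝ E] [NormedAddCommGroup F]
  [NormedSpace ℝ F]

/-- The integral over the unit interval of a smooth function depends smoothly on parameters. -/
theorem ContDiff.integral_unitInterval {G : E → ℝ → F}
    (hG : ContDiff ℝ ∞ (fun q : E × ℝ => G q.1 q.2)) :
    ContDiff ℝ ∞ (fun y => ∫ t in (0 : ℝ)..1, G y t) := by
  -- The integral is the convolution at `0` of the indicator of `(0, 1]` with `t ↦ χ t • G y (-t)`.
  -- The cutoff is `1` on `[-1, 1]`, so it does not change the integral, and it gives the compact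
  -- support that smoothness of convolutions with parameters requires.
  let χ : ContDiffBump (0 : ℝ) := ⟨1, 2, one_pos, one_lt_two⟩
  have key := contDiffOn_convolution_right_with_param_comp (𝕜 := ℝ) (n := (⊤ : ℕ∞)) (μ := volume)
    (ContinuousLinearMap.lsmul ℝ ℝ : ℝ →L[ℝ] F →L[ℝ] F) (s := (Set.univ : Set E))
    (v := fun _ : E => (0 : ℝ)) contDiffOn_const
    (f := Set.indicator (Set.Ioc (0 : ℝ) 1) (fun _ => (1 : ℝ)))
    (g := fun y t => χ t • G y (-t)) (k := Metric.closedBall 0 2) isOpen_univ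
    (isCompact_closedBall _ _) ?_ ?_ ?_
  · rw [contDiffOn_univ] at key
    convert key using 2 with y
    rw [intervalIntegral.integral_of_le zero_le_one, ← integral_indicator measurableSet_Ioc]
    refine integral_congr_ae (Filter.Eventually.of_forall fun t => ?_)
    by_cases ht : t ∈ Set.Ioc (0 : ℝ) 1
    · have h1 : χ (0 - t) = 1 := by
        refine χ.one_of_mem_closedBall ?_
        rw [Metric.mem_closedBall, dist_zero_right, zero_sub, norm_neg, Real.norm_eq_abs,
          abs_of_pos ht.1]
        exact ht.2
      simp only [Set.indicator_of_mem ht, h1]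
      simp
    · simp [Set.indicator_of_notMem ht]
  · intro y t _ ht
    have : χ t = 0 := by
      refine χ.zero_of_le_dist (le_of_lt ?_)
      simpa using ht
    simp [this]
  · exact ((integrable_indicator_iff measurableSet_Ioc).mpr (by simp)).locallyIntegrable
  · refine ContDiff.contDiffOn ?_
    exact (χ.contDiff.comp contDiff_snd).smul
      (hG.comp (contDiff_fst.prodMk contDiff_snd.neg))

/-- Integrate the derivative of `f` along the segment from `a` to `y` and expand `y - a` in the
standard basis: `g i y` is the integral over `t` of the `i`-th partial derivative at `a + t • (y -
a)`. -/
theorem ContDiff.exists_eq_add_sum_mul {p : ℕ} {f : EuclideanSpace ℝ (Fin p) → ℝ}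
    (hf : ContDiff ℝ ∞ f) (a : EuclideanSpace ℝ (Fin p)) :
    ∃ g : Fin p → EuclideanSpace ℝ (Fin p) → ℝ, (∀ i, ContDiff ℝ ∞ (g i)) ∧
      ∀ y, f y = f a + ∑ i, g i y * (y i - a i) := by
  let G : EuclideanSpace ℝ (Fin p) → ℝ → (EuclideanSpace ℝ (Fin p) →L[ℝ] ℝ) :=
    fun y t => fderiv ℝ f (a + t • (y - a))
  have hline : ContDiff ℝ ∞ (fun q : EuclideanSpace ℝ (Fin p) × ℝ => a + q.2 • (q.1 - a)) := by
    fun_prop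
  have hG : ContDiff ℝ ∞ (fun q : EuclideanSpace ℝ (Fin p) × ℝ => G q.1 q.2) :=
    (hf.fderiv_right (m := ∞) le_rfl).comp hline
  refine ⟨fun i y => (∫ t in (0 : ℝ)..1, G y t) (EuclideanSpace.single i 1),
    fun i => hG.integral_unitInterval.clm_apply contDiff_const, fun y => ?_⟩
  have hcont : Continuous (G y) := hG.continuous.comp (Continuous.prodMk_right y)
  have hderiv : ∀ t : ℝ, HasDerivAt (fun t : ℝ => f (a + t • (y - a))) (G y t (y - a)) t := by
    intro t
    have h1 : HasDerivAt (fun t : ℝ => a + t • (y - a)) (y - a) t := by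
      simpa using ((hasDerivAt_id t).smul_const (y - a)).const_add a
    exact ((hf.differentiable (by simp)).differentiableAt.hasFDerivAt).comp_hasDerivAt t h1
  have h2 := intervalIntegral.integral_eq_sub_of_hasDerivAt (a := 0) (b := 1)
    (fun t _ => hderiv t) ((hcont.clm_apply continuous_const).intervalIntegrable _ _)
  rw [← ContinuousLinearMap.intervalIntegral_apply (hcont.intervalIntegrable _ _)] at h2
  have h3 : y - a = ∑ i, (y i - a i) • EuclideanSpace.single i (1 : ℝ) := by
    ext j
    simp [Pi.single_apply]
  simp only [one_smul, zero_smul, add_zero, add_sub_cancel] at h2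
  rw [← sub_eq_iff_eq_add', ← h2]
  conv_lhs => rw [h3, map_sum]
  exact Finset.sum_congr rfl fun i _ => by rw [map_smul, smul_eq_mul, mul_comm]

end Hadamard

/-! ### The grading of the stalks -/

namespace Superspace

variable (M : Superspace.{u})

theorem res_mem_parity {U V : Opens M.space} (h : U ≤ V) {i : ZMod 2} {s : M.Sections V}
    (hs : s ∈ M.parity V i) : M.res h s ∈ M.parity U i :=
  M.parity_res U V h i s hs

theorem germ_mem_stalkParity {x : M.space} {U : Opens M.space} (hx : x ∈ U) {i : ZMod 2}
    {s : M.Sections U} (hs : s ∈ M.parity U i) : M.germ hx s ∈ M.stalkParity x i :=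
  (le_iSup (fun U : {U : Opens M.space // x ∈ U} =>
    (M.parity U.1 i).map (algGerm M.sheaf.obj x U.1 U.2).toLinearMap) ⟨U, hx⟩) ⟨s, hs, rfl⟩

/-- Restriction preserves parity, so the supremum defining `stalkParity` is directed and a single
homogeneous section suffices. -/
theorem mem_stalkParity {x : M.space} {i : ZMod 2} {g : M.Stalk x} :
    g ∈ M.stalkParity x i ↔
      ∃ (U : Opens M.space) (hx : x ∈ U) (s : M.Sections U), s ∈ M.parity U i ∧
        M.germ hx s = g := by
  refine ⟨fun h => ?_, ?_⟩
  · have : Nonempty {U : Opens M.space // x ∈ U} := ⟨⟨⊤, trivial⟩⟩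
    have hdir : Directed (· ≤ ·) fun U : {U : Opens M.space // x ∈ U} =>
        (M.parity U.1 i).map (algGerm M.sheaf.obj x U.1 U.2).toLinearMap := by
      rintro ⟨U, hU⟩ ⟨V, hV⟩
      refine ⟨⟨U ⊓ V, hU, hV⟩, ?_, ?_⟩
      · rintro _ ⟨s, hs, rfl⟩
        exact ⟨_, M.res_mem_parity inf_le_left hs, M.germ_res (U := U ⊓ V) ⟨hU, hV⟩ inf_le_left s⟩
      · rintro _ ⟨s, hs, rfl⟩
        exact ⟨_, M.res_mem_parity inf_le_right hs, M.germ_res (U := U ⊓ V) ⟨hU, hV⟩ inf_le_right s⟩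
    obtain ⟨⟨U, hU⟩, s, hs, e⟩ := (Submodule.mem_iSup_of_directed _ hdir).mp h
    exact ⟨U, hU, s, hs, e⟩
  · rintro ⟨U, hx, s, hs, rfl⟩
    exact M.germ_mem_stalkParity hx hs

/-- Two homogeneous germs are represented by homogeneous sections over a common open set. -/
theorem exists_germ_eq_germ_eq {x : M.space} {i j : ZMod 2} {g g' : M.Stalk x}
    (hg : g ∈ M.stalkParity x i) (hg' : g' ∈ M.stalkParity x j) :
    ∃ (U : Opens M.space) (hx : x ∈ U), ∃ s ∈ M.parity U i, ∃ s' ∈ M.parity U j,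
      M.germ hx s = g ∧ M.germ hx s' = g' := by
  obtain ⟨U, hU, s, hs, rfl⟩ := M.mem_stalkParity.mp hg
  obtain ⟨V, hV, t, ht, rfl⟩ := M.mem_stalkParity.mp hg'
  exact ⟨U ⊓ V, ⟨hU, hV⟩, _, M.res_mem_parity inf_le_left hs, _,
    M.res_mem_parity inf_le_right ht, M.germ_res _ _ _, M.germ_res _ _ _⟩

theorem isSuperalgebra_stalk (x : M.space) : IsSuperalgebra (M.stalkParity x) where
  isCompl := by
    refine ⟨Submodule.disjoint_def.mpr fun g hg hg' => ?_, codisjoint_iff.mpr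
      (eq_top_iff.mpr fun g _ => ?_)⟩
    · obtain ⟨U, hU, s, hs, t, ht, rfl, e⟩ := M.exists_germ_eq_germ_eq hg hg'
      obtain ⟨W, hW, iU, iV, e'⟩ := M.germ_eq hU hU e
      have h0 : M.res iU s = 0 := Submodule.disjoint_def.mp (M.superalgebra W).isCompl.disjoint _
        (M.res_mem_parity iU hs) (e' ▸ M.res_mem_parity iU ht)
      rw [← M.germ_res hW iU, h0, map_zero]
    · obtain ⟨U, hU, s, rfl⟩ := M.exists_germ_eq g
      obtain ⟨b, hb, c, hc, rfl⟩ := (M.superalgebra U).exists_eq_add s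
      rw [map_add]
      exact Submodule.add_mem_sup (M.germ_mem_stalkParity hU hb) (M.germ_mem_stalkParity hU hc)
  one_mem := map_one (M.germ (Opens.mem_top x)) ▸
    M.germ_mem_stalkParity (Opens.mem_top x) (M.superalgebra ⊤).one_mem
  mul_mem := fun i j a b ha hb => by
    obtain ⟨U, hU, s, hs, t, ht, rfl, rfl⟩ := M.exists_germ_eq_germ_eq ha hb
    rw [← map_mul]
    exact M.germ_mem_stalkParity hU ((M.superalgebra U).mul_mem i j s t hs ht)
  supercomm := fun i j a b ha hb => by
    obtain ⟨U, hU, s, hs, t, ht, rfl, rfl⟩ := M.exists_germ_eq_germ_eq ha hb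
    rw [← map_mul, (M.superalgebra U).supercomm i j s t hs ht, map_smul, map_mul]

theorem preservesParity_globalGerm (x : M.space) :
    PreservesParity (M.parity ⊤) (M.stalkParity x) (M.globalGerm x) :=
  fun _ _ hs => M.germ_mem_stalkParity (Opens.mem_top x) hs

theorem isWeilPointNear_comp_globalGerm {A : Type*} [Ring A] [Algebra ℝ A]
    {𝒜 : ZMod 2 → Submodule ℝ A} {N : Ideal A} (hA : IsSuperWeilAlgebra 𝒜 N) {x : M.space}
    (hval : ∀ g : M.Stalk x, ∃ r : ℝ, g - algebraMap ℝ _ r ∈ M.stalkIdeal x)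
    {xA : M.Stalk x →ₐ[ℝ] A} (h : PreservesParity (M.stalkParity x) 𝒜 xA) :
    M.IsWeilPointNear 𝒜 N x (xA.comp (M.globalGerm x)) where
  preservesParity := fun i s hs => h i _ (M.preservesParity_globalGerm x i s hs)
  near := fun s => by
    obtain ⟨r, hr⟩ := hval (M.globalGerm x s)
    refine ⟨r, ?_, ?_⟩
    · rwa [HasValueAt, map_sub, AlgHom.commutes]
    · have := hA.map_localMaxIdeal_le xA hr
      rwa [map_sub, AlgHom.commutes] at this

/-! ### Sections vanishing near a point -/

/-- A superspace has bump functions at `x` if every neighbourhood `U` of `x` admits a global section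
that is `1` near `x` and vanishes on an open set that covers the complement of `U`. -/
def HasBumps (x : M.space) : Prop :=
  ∀ U : Opens M.space, x ∈ U → ∃ (ρ : M.Global) (V O : Opens M.space),
    x ∈ V ∧ V ≤ U ∧ ⊤ ≤ U ⊔ O ∧ M.res (le_top : V ≤ ⊤) ρ = 1 ∧ M.res (le_top : O ≤ ⊤) ρ = 0

variable {M}

/-- A local section times a bump function extends by zero, without changing its germ. -/
theorem globalGerm_surjective {x : M.space} (hx : M.HasBumps x) :
    Function.Surjective (M.globalGerm x) := by
  intro g
  obtain ⟨U, hU, t, rfl⟩ := M.exists_germ_eq g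
  obtain ⟨ρ, V, O, hV, hVU, hUO, h1, h0⟩ := hx U hU
  obtain ⟨r, hr, -⟩ := M.exists_glue hUO (M.res le_top ρ * t) 0 (by
    rw [map_mul, res_res, ← M.res_res (inf_le_right : U ⊓ O ≤ O) le_top, h0, map_zero,
      zero_mul])
  refine ⟨r, ?_⟩
  change M.germ (Opens.mem_top x) r = _
  rw [← M.germ_res hV le_top, ← M.germ_res hV hVU t, ← M.res_res hVU le_top, hr, map_mul, res_res,
    h1, one_mul]

instance (x : M.space) : (M.pointIdeal x).IsTwoSided :=
  inferInstanceAs ((M.stalkIdeal x).comap (M.globalGerm x)).IsTwoSided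

/-- Choose `ρ` equal to `1` near `x` and vanishing away from a neighbourhood on which `s = 0`. Then
`s = (1 - ρ) * s` with `1 - ρ` in the ideal of `x`, and iterating gives every power. -/
theorem mem_pow_pointIdeal_of_globalGerm_eq_zero {x : M.space} (hx : M.HasBumps x) {s : M.Global}
    (hs : M.globalGerm x s = 0) (n : ℕ) : s ∈ M.pointIdeal x ^ n := by
  obtain ⟨U, hU, iU, _, e⟩ := M.germ_eq (s := s) (t := 0) (Opens.mem_top x) (Opens.mem_top x)
    (by rw [map_zero]; exact hs)
  obtain ⟨ρ, V, O, hV, hVU, hUO, h1, h0⟩ := hx U hU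
  have hρ : ρ * s = 0 := by
    refine M.eq_of_res_eq hUO ?_ ?_
    · rw [map_mul, e, map_zero, mul_zero]
    · rw [map_mul, h0, map_zero, zero_mul]
  have hmem : 1 - ρ ∈ M.pointIdeal x := by
    have : M.globalGerm x (1 - ρ) = 0 := by
      change M.germ (Opens.mem_top x) (1 - ρ) = 0
      rw [← M.germ_res hV le_top, map_sub, map_one, h1, sub_self, map_zero]
    rw [pointIdeal, Ideal.mem_comap, this]
    exact zero_mem _
  induction n with
  | zero => rw [Submodule.pow_zero, Ideal.one_eq_top]; trivial
  | succ n ih =>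
    rw [Ideal.IsTwoSided.pow_succ]
    have : s = (1 - ρ) * s := by rw [sub_mul, one_mul, hρ, sub_zero]
    rw [this]
    exact Ideal.mul_mem_mul hmem ih

/-- Surjectivity of the germ map lifts an element of the power of the stalk ideal to the same power
of `M.pointIdeal x`; the lift differs from `s` by a section with zero germ, which lies in every
power. -/
theorem mem_pow_pointIdeal {x : M.space} (hx : M.HasBumps x) {n : ℕ} {s : M.Global}
    (hs : M.globalGerm x s ∈ M.stalkIdeal x ^ n) : s ∈ M.pointIdeal x ^ n := by
  have key : ∀ (n : ℕ), ∀ g ∈ M.stalkIdeal x ^ n, ∃ t ∈ M.pointIdeal x ^ n,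
      M.globalGerm x t = g := by
    intro n
    induction n with
    | zero =>
      intro g _
      obtain ⟨t, rfl⟩ := globalGerm_surjective hx g
      exact ⟨t, by rw [Submodule.pow_zero, Ideal.one_eq_top]; trivial, rfl⟩
    | succ n ih =>
      intro g hg
      rw [Submodule.pow_succ] at hg ⊢
      induction hg using Submodule.mul_induction_on' with
      | mem_mul_mem a ha b hb =>
        obtain ⟨s, hs, rfl⟩ := ih a ha
        -- Since `pointIdeal` is a preimage, `hb` becomes the membership of `t` in it.
        obtain ⟨t, rfl⟩ := globalGerm_surjective hx b
        exact ⟨s * t, Ideal.mul_mem_mul hs hb, map_mul _ _ _⟩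
      | add a _ b _ ha hb =>
        obtain ⟨s, hs, rfl⟩ := ha
        obtain ⟨t, ht, rfl⟩ := hb
        exact ⟨s + t, add_mem hs ht, map_add _ _ _⟩
  obtain ⟨t, ht, e⟩ := key n _ hs
  have := mem_pow_pointIdeal_of_globalGerm_eq_zero hx (s := s - t)
    (by rw [map_sub, e, sub_self]) n
  simpa using add_mem this ht

/-- Over a field, a functional factors through a linear map as soon as it vanishes on the kernel;
here the kernel lies in `M.pointIdeal x ^ (k + 1)`. -/
theorem exists_dual_jet {x : M.space} (hx : M.HasBumps x) {k : ℕ} {v : Module.Dual ℝ M.Global}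
    (hv : v ∈ M.distributionsOfOrder x (k + 1)) :
    ∃ w : Module.Dual ℝ (M.Jet x k),
      v = w ∘ₗ ((M.jetProj x k).comp (M.globalGerm x)).toLinearMap := by
  have : v ∈ LinearMap.range ((M.jetProj x k).comp (M.globalGerm x)).toLinearMap.dualMap := by
    rw [LinearMap.range_dualMap_eq_dualAnnihilator_ker, Submodule.mem_dualAnnihilator]
    intro s hs
    exact hv s (mem_pow_pointIdeal hx (Ideal.Quotient.eq_zero_iff_mem.mp hs))
  obtain ⟨w, hw⟩ := this
  exact ⟨w, hw.symm⟩

end Superspace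

noncomputable section

/-! ### Smooth functions on open subsets of `ℝᵖ` -/

section Smooth

variable {p q : ℕ} {W W' : Opens (EuclideanSpace ℝ (Fin p))}

/-- The restriction to an open subset of a smooth function on `ℝᵖ`. -/
def smoothOfContDiff (W : Opens (EuclideanSpace ℝ (Fin p))) {f : EuclideanSpace ℝ (Fin p) → ℝ}
    (hf : ContDiff ℝ ∞ f) : SmoothFun p W :=
  ⟨fun y => f y, hf.contMDiff.comp contMDiff_subtype_val⟩

@[simp]
theorem smoothOfContDiff_apply {f : EuclideanSpace ℝ (Fin p) → ℝ} (hf : ContDiff ℝ ∞ f) (y : W) :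
    smoothOfContDiff W hf y = f y :=
  rfl

@[simp]
theorem smoothRes_apply (h : W ≤ W') (f : SmoothFun p W') (y : W) :
    smoothRes p h f y = f ⟨y, h y.2⟩ :=
  rfl

theorem smoothRes_smoothOfContDiff (h : W ≤ W') {f : EuclideanSpace ℝ (Fin p) → ℝ}
    (hf : ContDiff ℝ ∞ f) : smoothRes p h (smoothOfContDiff W' hf) = smoothOfContDiff W hf :=
  rfl

/-- Every smooth function on a neighbourhood of `a` agrees near `a` with a smooth function on the
whole space. -/
theorem exists_smoothRes_eq (f : SmoothFun p W) {a : EuclideanSpace ℝ (Fin p)} (ha : a ∈ W) :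
    ∃ (F : EuclideanSpace ℝ (Fin p) → ℝ) (hF : ContDiff ℝ ∞ F)
      (V : Opens (EuclideanSpace ℝ (Fin p))) (_ : a ∈ V) (h : V ≤ W),
      smoothRes p h f = smoothOfContDiff V hF := by
  classical
  obtain ⟨r, hr, hrW⟩ := Metric.nhds_basis_closedBall.mem_iff.mp (W.isOpen.mem_nhds ha)
  -- The cutoff vanishes outside a closed ball contained in `W`, so its product with the extension
  -- by zero `f'` is smooth everywhere; on the ball of radius `r / 2` the product is `f`.
  let χ : ContDiffBump a := ⟨r / 2, r, half_pos hr, half_lt_self hr⟩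
  let f' : EuclideanSpace ℝ (Fin p) → ℝ := fun y => if h : y ∈ W then f ⟨y, h⟩ else 0
  have hf' : ∀ y ∈ W, ContDiffAt ℝ ∞ f' y := by
    intro y hy
    have h1 : ContMDiffAt 𝓘(ℝ, EuclideanSpace ℝ (Fin p)) 𝓘(ℝ, ℝ) ∞
        (fun z : W => f' z) ⟨y, hy⟩ := by
      have : (fun z : W => f' z) = f := by
        ext z
        simp [f']
      rw [this]
      exact f.contMDiff _
    exact (contMDiffAt_subtype_iff.mp h1).contDiffAt
  have hF : ContDiff ℝ ∞ (fun y => χ y * f' y) := by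
    rw [contDiff_iff_contDiffAt]
    intro y
    by_cases hy : y ∈ W
    · exact χ.contDiff.contDiffAt.mul (hf' y hy)
    · have hy' : (Metric.closedBall a r)ᶜ ∈ nhds y :=
        Metric.isClosed_closedBall.isOpen_compl.mem_nhds fun h => hy (hrW h)
      refine (contDiffAt_const (c := (0 : ℝ))).congr_of_eventuallyEq ?_
      filter_upwards [hy'] with z hz
      have : χ z = 0 := χ.zero_of_le_dist (le_of_lt (by simpa using hz))
      rw [this, zero_mul]
  refine ⟨_, hF, ⟨Metric.ball a (r / 2), Metric.isOpen_ball⟩,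
    Metric.mem_ball_self (half_pos hr), fun y hy => hrW ?_, ?_⟩
  · exact Metric.ball_subset_closedBall (Metric.ball_subset_ball (half_le_self hr.le) hy)
  · ext ⟨y, hy⟩
    have h1 : χ y = 1 := χ.one_of_mem_closedBall (Metric.ball_subset_closedBall hy)
    have h2 : y ∈ W :=
      hrW (Metric.ball_subset_closedBall (Metric.ball_subset_ball (half_le_self hr.le) hy))
    simp [f', h1, h2]

/-- Evaluation of smooth functions at a point. -/
def smoothEval {a : EuclideanSpace ℝ (Fin p)} (ha : a ∈ W) : SmoothFun p W →ₐ[ℝ] ℝ where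
  toFun f := f ⟨a, ha⟩
  map_one' := rfl
  map_mul' _ _ := rfl
  map_zero' := rfl
  map_add' _ _ := rfl
  commutes' _ := rfl

/-- The value at a point of a section of the local model. -/
def modelEval (q : ℕ) {a : EuclideanSpace ℝ (Fin p)} (ha : a ∈ W) : ModelSections p q W →ₐ[ℝ] ℝ :=
  Algebra.TensorProduct.lift (smoothEval ha) ExteriorAlgebra.algebraMapInv
    fun _ _ => Commute.all _ _

theorem modelEval_tmul {a : EuclideanSpace ℝ (Fin p)} (ha : a ∈ W) (f : SmoothFun p W)
    (l : Grassmann q) :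
    modelEval q ha (f ⊗ₜ l) = f ⟨a, ha⟩ * ExteriorAlgebra.algebraMapInv l :=
  rfl

theorem modelRes_tmul (h : W ≤ W') (f : SmoothFun p W') (l : Grassmann q) :
    modelRes p q h (f ⊗ₜ l) = smoothRes p h f ⊗ₜ l :=
  rfl

theorem modelEval_modelRes {a : EuclideanSpace ℝ (Fin p)} (ha : a ∈ W) (h : W ≤ W')
    (s : ModelSections p q W') : modelEval q ha (modelRes p q h s) = modelEval q (h ha) s := by
  induction s using TensorProduct.induction_on with
  | zero => simp
  | tmul f l => rfl
  | add x y hx hy => rw [map_add, map_add, map_add, hx, hy]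

end Smooth

/-! ### Stalks in a chart -/

namespace SuperChart

variable {p q : ℕ} {M : Superspace.{u}} (c : SuperChart p q M)

/-- The open set of the points of the chart with coordinates in `W`. -/
def dom (W : Opens (EuclideanSpace ℝ (Fin p))) : Opens M.space :=
  ⟨c.φ.source ∩ c.φ ⁻¹' W, c.φ.isOpen_inter_preimage W.isOpen⟩

theorem dom_mono {W W' : Opens (EuclideanSpace ℝ (Fin p))} (h : W ≤ W') : c.dom W ≤ c.dom W' :=
  Set.inter_subset_inter_right _ (Set.preimage_mono h)

/-- The target of the chart. -/
def tgt : Opens (EuclideanSpace ℝ (Fin p)) := ⟨c.φ.target, c.φ.open_target⟩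

/-- The section with given coordinate expression. -/
def sec {W : Opens (EuclideanSpace ℝ (Fin p))} (hW : W ≤ c.tgt) :
    ModelSections p q W ≃ₐ[ℝ] M.Sections (c.dom W) :=
  (c.iso W hW).symm

theorem res_sec {W W' : Opens (EuclideanSpace ℝ (Fin p))} (hW' : W' ≤ c.tgt) (h : W ≤ W')
    (s : ModelSections p q W') :
    M.res (c.dom_mono h) (c.sec hW' s) = c.sec (h.trans hW') (modelRes p q h s) := by
  refine (c.iso W (h.trans hW')).injective ?_
  refine (c.iso_res W W' (h.trans hW') hW' h _).trans ?_
  rw [sec, sec]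
  refine Eq.trans ?_ ((c.iso W (h.trans hW')).apply_symm_apply _).symm
  exact congrArg _ ((c.iso W' hW').apply_symm_apply s)

/-- The coordinates of the points of an open set. -/
def coords (U : Opens M.space) : Opens (EuclideanSpace ℝ (Fin p)) :=
  ⟨c.φ.target ∩ c.φ.symm ⁻¹' U, c.φ.isOpen_inter_preimage_symm U.isOpen⟩

theorem coords_le (U : Opens M.space) : c.coords U ≤ c.tgt := Set.inter_subset_left

theorem dom_coords_le (U : Opens M.space) : c.dom (c.coords U) ≤ U := by
  rintro y ⟨hy, -, hyU⟩
  simpa [c.φ.left_inv hy] using hyU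

theorem apply_mem_coords {U : Opens M.space} {x : M.space} (hx : x ∈ c.φ.source) (hU : x ∈ U) :
    c.φ x ∈ c.coords U :=
  ⟨c.φ.map_source hx, by simpa [c.φ.left_inv hx] using hU⟩

variable {x : M.space} (hx : x ∈ c.φ.source)

/-- The germ at `x` of the section with given coordinate expression. -/
def germ {W : Opens (EuclideanSpace ℝ (Fin p))} (hW : W ≤ c.tgt) (ha : c.φ x ∈ W) :
    ModelSections p q W →ₐ[ℝ] M.Stalk x :=
  (M.germ (U := c.dom W) ⟨hx, ha⟩).comp (c.sec hW).toAlgHom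

theorem germ_res {W W' : Opens (EuclideanSpace ℝ (Fin p))} (hW' : W' ≤ c.tgt) (h : W ≤ W')
    (ha : c.φ x ∈ W) (s : ModelSections p q W') :
    c.germ hx (h.trans hW') ha (modelRes p q h s) = c.germ hx hW' (h ha) s := by
  change M.germ _ (c.sec (h.trans hW') (modelRes p q h s)) = M.germ _ (c.sec hW' s)
  rw [← c.res_sec hW' h]
  exact M.germ_res _ (c.dom_mono h) _

theorem exists_germ_eq (g : M.Stalk x) :
    ∃ (W : Opens (EuclideanSpace ℝ (Fin p))) (hW : W ≤ c.tgt) (ha : c.φ x ∈ W)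
      (s : ModelSections p q W), c.germ hx hW ha s = g := by
  obtain ⟨U, hU, s, rfl⟩ := M.exists_germ_eq g
  refine ⟨c.coords U, c.coords_le U, c.apply_mem_coords hx hU,
    (c.sec (c.coords_le U)).symm (M.res (c.dom_coords_le U) s), ?_⟩
  change M.germ _ (c.sec (c.coords_le U) _) = _
  rw [AlgEquiv.apply_symm_apply]
  exact M.germ_res _ (c.dom_coords_le U) s

/-- The value at `x` depends only on the germ: a section with zero germ has zero coordinate
expression on a smaller neighbourhood, where the value can be read off. -/
theorem modelEval_eq_zero {W : Opens (EuclideanSpace ℝ (Fin p))} (hW : W ≤ c.tgt)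
    (ha : c.φ x ∈ W) {s : ModelSections p q W} (h : c.germ hx hW ha s = 0) :
    modelEval q ha s = 0 := by
  have h' : M.germ (U := c.dom W) ⟨hx, ha⟩ (c.sec hW s) =
    M.germ (U := c.dom W) ⟨hx, ha⟩ 0 := by rw [map_zero]; exact h
  obtain ⟨U, hU, iU, _, e⟩ := M.germ_eq _ _ h'
  rw [map_zero] at e
  have hV : W ⊓ c.coords U ≤ W := inf_le_left
  have haV : c.φ x ∈ W ⊓ c.coords U := ⟨ha, c.apply_mem_coords hx hU⟩
  have hVU : c.dom (W ⊓ c.coords U) ≤ U := (c.dom_mono inf_le_right).trans (c.dom_coords_le U)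
  have h0 : c.sec (hV.trans hW) (modelRes p q hV s) = 0 := by
    rw [← c.res_sec hW hV, ← M.res_res hVU iU, e, map_zero]
  rw [EmbeddingLike.map_eq_zero_iff] at h0
  rw [← modelEval_modelRes haV hV, h0, map_zero]

/-- If the germ had an inverse, represented by `t` on a common neighbourhood, then `s * t - 1` would
have zero germ and hence value zero; but its value is `-1`. -/
theorem germ_mem_stalkIdeal {W : Opens (EuclideanSpace ℝ (Fin p))} (hW : W ≤ c.tgt)
    (ha : c.φ x ∈ W) {s : ModelSections p q W} (h : modelEval q ha s = 0) :
    c.germ hx hW ha s ∈ M.stalkIdeal x := by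
  intro hu
  obtain ⟨g, hg⟩ := hu.exists_right_inv
  obtain ⟨W', hW', ha', t, rfl⟩ := c.exists_germ_eq hx g
  have iW : W ⊓ W' ≤ W := inf_le_left
  have iW' : W ⊓ W' ≤ W' := inf_le_right
  have haV : c.φ x ∈ W ⊓ W' := ⟨ha, ha'⟩
  rw [← c.germ_res hx hW iW haV, ← c.germ_res hx hW' iW' haV, ← map_mul, ← sub_eq_zero,
    ← map_one (c.germ hx (iW.trans hW) haV), ← map_sub] at hg
  have := c.modelEval_eq_zero hx (iW.trans hW) haV hg
  rw [map_sub, map_mul, modelEval_modelRes, h, zero_mul, map_one] at this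
  norm_num at this

include hx in
theorem exists_sub_algebraMap_mem (g : M.Stalk x) :
    ∃ r : ℝ, g - algebraMap ℝ _ r ∈ M.stalkIdeal x := by
  obtain ⟨W, hW, ha, s, rfl⟩ := c.exists_germ_eq hx g
  refine ⟨modelEval q ha s, ?_⟩
  rw [← AlgHom.commutes (c.germ hx hW ha), ← map_sub]
  exact c.germ_mem_stalkIdeal hx hW ha (by rw [map_sub, AlgHom.commutes]; simp)

end SuperChart

end

/-! ### Coordinate germs generate the maximal ideal; bump functions from a chart -/

noncomputable section

theorem ExteriorAlgebra.algebraMapInv_ι {R V : Type*} [CommRing R] [AddCommGroup V] [Module R V]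
    (m : V) : ExteriorAlgebra.algebraMapInv (ExteriorAlgebra.ι R m) = 0 := by
  simp [ExteriorAlgebra.algebraMapInv]

namespace SuperChart

variable {p q : ℕ} {M : Superspace.{u}} (c : SuperChart p q M) {x : M.space}
  (hx : x ∈ c.φ.source)

include hx in
theorem apply_mem_tgt : c.φ x ∈ c.tgt := c.φ.map_source hx

theorem contDiff_coord (a : EuclideanSpace ℝ (Fin p)) (i : Fin p) :
    ContDiff ℝ ∞ (fun y : EuclideanSpace ℝ (Fin p) => y i - a i) := by
  fun_prop

/-- The germs of the even coordinates, centred at `x`. -/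
def evenCoord (i : Fin p) : M.Stalk x :=
  c.germ hx le_rfl (c.apply_mem_tgt hx) (smoothOfContDiff c.tgt (contDiff_coord (c.φ x) i) ⊗ₜ 1)

/-- The germs of the odd coordinates. -/
def oddCoord (j : Fin q) : M.Stalk x :=
  c.germ hx le_rfl (c.apply_mem_tgt hx) (1 ⊗ₜ ExteriorAlgebra.ι ℝ (Pi.single j 1))

/-- The left ideal generated by the germs of the coordinates. -/
def coordIdeal : Ideal (M.Stalk x) :=
  Ideal.span (Set.range (c.evenCoord hx) ∪ Set.range (c.oddCoord hx))

variable {W : Opens (EuclideanSpace ℝ (Fin p))} (hW : W ≤ c.tgt) (ha : c.φ x ∈ W)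

/-- The germ of `f` is that of a smooth function on all of `ℝᵖ`, where Hadamard's lemma writes the
difference from the value as a combination of the centred coordinates. -/
theorem germ_smooth_sub_mem (f : SmoothFun p W) :
    c.germ hx hW ha (f ⊗ₜ 1) - algebraMap ℝ _ (f ⟨c.φ x, ha⟩) ∈ c.coordIdeal hx := by
  obtain ⟨F, hF, V, haV, hV, e⟩ := exists_smoothRes_eq f ha
  obtain ⟨g, hg, hFg⟩ := hF.exists_eq_add_sum_mul (c.φ x)
  have hval : f ⟨c.φ x, ha⟩ = F (c.φ x) := congrArg (fun f => f ⟨c.φ x, haV⟩) e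
  have hexp : smoothOfContDiff V hF = algebraMap ℝ _ (F (c.φ x)) +
      ∑ i, smoothOfContDiff V (hg i) * smoothOfContDiff V (contDiff_coord (c.φ x) i) := by
    ext y
    -- Evaluation is used as an algebra map, so that it passes through the constant and the sum.
    have h1 : (smoothEval (p := p) y.2) (smoothOfContDiff V hF) = (smoothEval y.2)
        (algebraMap ℝ _ (F (c.φ x)) +
          ∑ i, smoothOfContDiff V (hg i) * smoothOfContDiff V (contDiff_coord (c.φ x) i)) := by
      rw [map_add, AlgHom.commutes, map_sum]
      exact hFg y
    exact h1
  have hres : c.germ hx hW ha (f ⊗ₜ 1) =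
      c.germ hx (hV.trans hW) haV (smoothOfContDiff V hF ⊗ₜ 1) := by
    rw [← c.germ_res hx hW hV haV, modelRes_tmul, e]
  let ψ : SmoothFun p V →ₐ[ℝ] M.Stalk x :=
    (c.germ hx (hV.trans hW) haV).comp Algebra.TensorProduct.includeLeft
  have hψ : ∀ i, ψ (smoothOfContDiff V (contDiff_coord (c.φ x) i)) = c.evenCoord hx i := fun i =>
    c.germ_res hx le_rfl (hV.trans hW) haV
      (smoothOfContDiff c.tgt (contDiff_coord (c.φ x) i) ⊗ₜ 1)
  change _ = ψ _ at hres
  rw [hres, hval, hexp, map_add, AlgHom.commutes, add_sub_cancel_left, map_sum]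
  refine sum_mem fun i _ => ?_
  rw [map_mul, hψ]
  exact Ideal.mul_mem_left _ _ (Submodule.subset_span (Or.inl ⟨i, rfl⟩))

/-- `coordIdeal` is a left ideal, so the induction multiplies by generators on the right: a product
ending in a generator lies in the ideal and has scalar part zero. -/
theorem germ_grassmann_sub_mem (l : Grassmann q) :
    c.germ hx hW ha (1 ⊗ₜ l) - algebraMap ℝ _ (ExteriorAlgebra.algebraMapInv l) ∈
      c.coordIdeal hx := by
  let ψ : Grassmann q →ₐ[ℝ] M.Stalk x :=
    (c.germ hx hW ha).comp Algebra.TensorProduct.includeRight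
  have hψ : ∀ j, ψ (ExteriorAlgebra.ι ℝ (Pi.single j 1)) = c.oddCoord hx j := fun j =>
    c.germ_res hx le_rfl hW ha (1 ⊗ₜ ExteriorAlgebra.ι ℝ (Pi.single j 1))
  change ψ l - _ ∈ _
  induction l using CliffordAlgebra.right_induction with
  | algebraMap r =>
    rw [AlgHom.commutes, AlgHom.commutes]
    simp
  | add l l' h h' =>
    rw [map_add, map_add, map_add, add_sub_add_comm]
    exact add_mem h h'
  | mul_ι m l _ =>
    have hm : ψ (ExteriorAlgebra.ι ℝ m) ∈ c.coordIdeal hx := by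
      rw [pi_eq_sum_univ' m, map_sum, map_sum]
      refine sum_mem fun j _ => ?_
      rw [map_smul, map_smul, hψ, Algebra.smul_def]
      exact Ideal.mul_mem_left _ _ (Submodule.subset_span (Or.inr ⟨j, rfl⟩))
    have h0 : ExteriorAlgebra.algebraMapInv (CliffordAlgebra.ι (0 : QuadraticForm ℝ (Fin q → ℝ)) m)
        = 0 := ExteriorAlgebra.algebraMapInv_ι m
    rw [map_mul, map_mul, h0, mul_zero, map_zero, sub_zero]
    exact Ideal.mul_mem_left _ _ hm

theorem germ_sub_mem (s : ModelSections p q W) :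
    c.germ hx hW ha s - algebraMap ℝ _ (modelEval q ha s) ∈ c.coordIdeal hx := by
  induction s using TensorProduct.induction_on with
  | zero => simp
  | add s t hs ht =>
    rw [map_add, map_add, map_add, add_sub_add_comm]
    exact add_mem hs ht
  | tmul f l =>
    have h1 := c.germ_smooth_sub_mem hx hW ha f
    have h2 := c.germ_grassmann_sub_mem hx hW ha l
    have e : (f ⊗ₜ l : ModelSections p q W) = (f ⊗ₜ 1) * (1 ⊗ₜ l) := by
      rw [Algebra.TensorProduct.tmul_mul_tmul, mul_one, one_mul]
    rw [e, map_mul, ← e, modelEval_tmul, map_mul]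
    set a := c.germ hx hW ha (f ⊗ₜ 1)
    set b := c.germ hx hW ha (1 ⊗ₜ l)
    set r := f ⟨c.φ x, ha⟩
    set t := ExteriorAlgebra.algebraMapInv l
    -- Scalars are central, which allows each summand to have its element of the left ideal as the
    -- right factor.
    have : a * b - algebraMap ℝ (M.Stalk x) r * algebraMap ℝ _ t =
        a * (b - algebraMap ℝ _ t) + algebraMap ℝ _ t * (a - algebraMap ℝ _ r) := by
      rw [mul_sub, mul_sub, Algebra.commutes t a, Algebra.commutes t (algebraMap ℝ _ r)]
      abel
    rw [this]
    exact add_mem (Ideal.mul_mem_left _ _ h2) (Ideal.mul_mem_left _ _ h1)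

/-- The coordinates have value zero, so they generate only non-units. Conversely every germ is a
scalar modulo `coordIdeal`, and for a non-unit this scalar is itself a non-unit, hence zero. -/
theorem stalkIdeal_eq_coordIdeal : M.stalkIdeal x = c.coordIdeal hx := by
  have key : ∀ g : M.Stalk x, ∃ r : ℝ, g - algebraMap ℝ _ r ∈ c.coordIdeal hx := fun g => by
    obtain ⟨W, hW, ha, s, rfl⟩ := c.exists_germ_eq hx g
    exact ⟨_, c.germ_sub_mem hx hW ha s⟩
  have hle : c.coordIdeal hx ≤ M.stalkIdeal x := by
    refine Ideal.span_le.mpr ?_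
    rintro _ (⟨i, rfl⟩ | ⟨j, rfl⟩)
    · exact c.germ_mem_stalkIdeal hx _ _ (by rw [modelEval_tmul]; simp)
    · exact c.germ_mem_stalkIdeal hx _ _ (by
        rw [modelEval_tmul, ExteriorAlgebra.algebraMapInv_ι, mul_zero])
  refine le_antisymm (fun g hg => ?_) hle
  obtain ⟨r, hr⟩ := key g
  have h0 := sub_mem hg (hle hr)
  rw [sub_sub_cancel, algebraMap_mem_localMaxIdeal] at h0
  simpa [h0] using hr

include hx in
theorem fg_stalkIdeal : (M.stalkIdeal x).FG := by
  rw [c.stalkIdeal_eq_coordIdeal hx]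
  exact Submodule.fg_span ((Set.finite_range _).union (Set.finite_range _))

include hx in
-- A closed ball in the chart corresponds to a compact set `K` in `M`, closed because `M` is
-- Hausdorff. A bump function supported in the ball can thus be glued with zero on the complement of
-- `K`.
theorem hasBumps [T2Space M.space] : M.HasBumps x := by
  intro U hU
  obtain ⟨r, hr, hrU⟩ := Metric.nhds_basis_closedBall.mem_iff.mp
    ((c.coords U).isOpen.mem_nhds (c.apply_mem_coords hx hU))
  let χ : ContDiffBump (c.φ x) := ⟨r / 2, r, half_pos hr, half_lt_self hr⟩
  have hχ : ContDiff ℝ ∞ χ := χ.contDiff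
  let K : Set M.space := c.φ.symm '' Metric.closedBall (c.φ x) r
  have hK : IsClosed K := ((isCompact_closedBall _ _).image_of_continuousOn
    (c.φ.symm.continuousOn.mono fun y hy => (hrU hy).1)).isClosed
  let O : Opens M.space := ⟨Kᶜ, hK.isOpen_compl⟩
  have hcov : ⊤ ≤ c.dom (c.coords U) ⊔ O := by
    intro y _
    by_cases hy : y ∈ K
    · obtain ⟨z, hz, rfl⟩ := hy
      refine Or.inl ⟨c.φ.map_target (hrU hz).1, ?_⟩
      change c.φ (c.φ.symm z) ∈ c.coords U
      rw [c.φ.right_inv (hrU hz).1]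
      exact hrU hz
    · exact Or.inr hy
  -- The bump function is identically `0` on `W₀`, which contains the coordinates of the overlap
  -- with `O`, and identically `1` on `W₁`.
  let W₀ : Opens (EuclideanSpace ℝ (Fin p)) :=
    ⟨c.coords U ∩ (Metric.closedBall (c.φ x) r)ᶜ,
      (c.coords U).isOpen.inter Metric.isClosed_closedBall.isOpen_compl⟩
  let W₁ : Opens (EuclideanSpace ℝ (Fin p)) := ⟨Metric.ball (c.φ x) (r / 2), Metric.isOpen_ball⟩
  have h₀ : W₀ ≤ c.coords U := Set.inter_subset_left
  have h₁ : W₁ ≤ c.coords U := fun y hy =>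
    hrU (Metric.ball_subset_closedBall (Metric.ball_subset_ball (half_le_self hr.le) hy))
  have hint : c.dom (c.coords U) ⊓ O ≤ c.dom W₀ := by
    rintro y ⟨⟨hy, hyU⟩, hyK⟩
    exact ⟨hy, hyU, fun h => hyK ⟨c.φ y, h, c.φ.left_inv hy⟩⟩
  let σ := c.sec (c.coords_le U) (smoothOfContDiff (c.coords U) hχ ⊗ₜ 1)
  have hσ₀ : M.res (c.dom_mono h₀) σ = 0 := by
    rw [c.res_sec (c.coords_le U) h₀, modelRes_tmul, smoothRes_smoothOfContDiff]
    have : smoothOfContDiff W₀ hχ = 0 := by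
      ext ⟨y, hy⟩
      exact χ.zero_of_le_dist (le_of_lt (by simpa using hy.2))
    rw [this, TensorProduct.zero_tmul, map_zero]
  have hσ₁ : M.res (c.dom_mono h₁) σ = 1 := by
    rw [c.res_sec (c.coords_le U) h₁, modelRes_tmul, smoothRes_smoothOfContDiff]
    have : smoothOfContDiff W₁ hχ = 1 := by
      ext ⟨y, hy⟩
      exact χ.one_of_mem_closedBall (Metric.ball_subset_closedBall hy)
    rw [this, ← Algebra.TensorProduct.one_def, map_one]
  obtain ⟨ρ, h1, h0⟩ := M.exists_glue hcov σ 0 (by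
    rw [map_zero, ← M.res_res hint (c.dom_mono h₀), hσ₀, map_zero])
  refine ⟨ρ, c.dom W₁, O, ⟨hx, Metric.mem_ball_self (half_pos hr)⟩,
    (c.dom_mono h₁).trans (c.dom_coords_le U), hcov.trans (sup_le_sup_right (c.dom_coords_le U) O),
    ?_, h0⟩
  rw [← M.res_res (c.dom_mono h₁) le_top, h1, hσ₁]

end SuperChart

end

/-! ### The theorem -/

theorem mainTheorem10 {p q : ℕ} (M : Superspace.{u}) (hM : IsSupermanifold p q M)
    (x : M.space) :
    -- every `w ∘ xA` is a distribution supported at `x`, for `xA` a map from the global sections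
    (∀ (A : Type*) [Ring A] [Algebra ℝ A] (𝒜 : ZMod 2 → Submodule ℝ A) (N : Ideal A),
      IsSuperWeilAlgebra 𝒜 N →
        (∀ xA : M.Global →ₐ[ℝ] A, M.IsWeilPointNear 𝒜 N x xA →
          ∀ w : Module.Dual ℝ A, w ∘ₗ xA.toLinearMap ∈ M.distributions x) ∧
        -- the same for `xA` given as a superalgebra map from the stalk
        (∀ xA : M.Stalk x →ₐ[ℝ] A, PreservesParity (M.stalkParity x) 𝒜 xA →
          M.IsWeilPointNear 𝒜 N x (xA.comp (M.globalGerm x)) ∧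
          ∀ w : Module.Dual ℝ A,
            w ∘ₗ (xA.comp (M.globalGerm x)).toLinearMap ∈ M.distributions x)) ∧
    -- every distribution of order `k` arises from the projection of the stalk to `O_x / m_x^(k+1)`
    (∀ k : ℕ,
      IsSuperWeilAlgebra (M.jetParity x k) (M.jetIdeal x k) ∧
      PreservesParity (M.stalkParity x) (M.jetParity x k) (M.jetProj x k) ∧
      M.IsWeilPointNear (M.jetParity x k) (M.jetIdeal x k) x
        ((M.jetProj x k).comp (M.globalGerm x)) ∧
      (∀ v ∈ M.distributionsOfOrder x k, ∃ w : Module.Dual ℝ (M.Jet x k),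
        v = w ∘ₗ ((M.jetProj x k).comp (M.globalGerm x)).toLinearMap) ∧
      -- the same for the functionals that are only assumed to vanish on the power `k + 1`
      (∀ v ∈ M.distributionsOfOrder x (k + 1), ∃ w : Module.Dual ℝ (M.Jet x k),
        v = w ∘ₗ ((M.jetProj x k).comp (M.globalGerm x)).toLinearMap)) := by
  obtain ⟨c, hx⟩ := hM.exists_chart x
  have := hM.t2Space
  have hval := c.exists_sub_algebraMap_mem hx
  have hbumps := c.hasBumps hx
  have hjet : ∀ k, IsSuperWeilAlgebra (M.jetParity x k) (M.jetIdeal x k) := fun k =>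
    (M.isSuperalgebra_stalk x).isSuperWeilAlgebra_quotient hval (c.fg_stalkIdeal hx) k
  have hproj : ∀ k, PreservesParity (M.stalkParity x) (M.jetParity x k) (M.jetProj x k) :=
    fun k i a ha => ⟨a, ha, rfl⟩
  refine ⟨fun A _ _ 𝒜 N hA => ⟨fun xA h w => h.comp_mem_distributions M hA w, fun xA h => ?_⟩,
    fun k => ⟨hjet k, hproj k, M.isWeilPointNear_comp_globalGerm (hjet k) hval (hproj k),
      fun v hv => ?_, fun v hv => Superspace.exists_dual_jet hbumps hv⟩⟩
  · have h' := M.isWeilPointNear_comp_globalGerm hA hval h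
    exact ⟨h', fun w => h'.comp_mem_distributions M hA w⟩
  -- Powers of an ideal decrease, so order `k` is a special case of vanishing on the power `k + 1`.
  · exact Superspace.exists_dual_jet hbumps fun s hs => hv s (Ideal.pow_le_pow_right k.le_succ hs)
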